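/- Let $n\ge 1$ and let $\mathcal{M}_n$ be the space of complex $n\times n$ matrices with the Hilbert--Schmidt inner product $\langle A,B\rangle=\operatorname{tr}(A^\dagger B)$. Let $\mathcal{E}:\mathcal{M}_n\to\mathcal{M}_n$ be a nonzero positive linear map (that is, $\mathcal{E}(A)\ge 0$ whenever $A\ge 0$) which is fully indecomposable: whenever $P,Q$ are nonzero orthogonal projections of the same rank with $\mathcal{E}(P\mathcal{M}_nP)\subseteq Q\mathcal{M}_nQ$, then $P=Q=\mathbb{1}$. For $X,Y\in\mathcal{M}_n$ write $\mathcal{E}_{X,Y}(\cdot):=Y^\dagger\mathcal{E}(X\cdot X^\dagger)Y$, and call a linear map $\mathcal{T}$ doubly stochastic if $\mathcal{T}(\mathbb{1})=\mathbb{1}$ and $\mathcal{T}^*(\mathbb{1})=\mathbb{1}$, where $\mathcal{T}^*$ is the adjoint of $\mathcal{T}$. Then there is a unique scaling of $\mathcal{E}$ to a doubly stochastic map, in the following sense. 1. There are positive definite $X,Y\in\mathcal{M}_n$ such that $\mathcal{E}_{X,Y}$ is doubly stochastic, and they are unique up to a scalar: if $X',Y'$ are positive definite and $\mathcal{E}_{X',Y'}$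 is doubly stochastic, then $X'=cX$ and $Y'=c^{-1}Y$ for some $c>0$. Moreover, for arbitrary $X',Y'\in\mathcal{M}_n$, the map $\mathcal{E}_{X',Y'}$ is doubly stochastic if and only if $X'=cXU$ and $Y'=c^{-1}YV$ for some $c>0$ and unitary $U,V\in\mathcal{M}_n$. 2. There is exactly one doubly stochastic map $\mathcal{T}$ of the form $\mathcal{T}=\mathcal{E}_{X,Y}$ with $X,Y$ positive definite. -/

import Mathlib

open scoped ComplexOrder MatrixOrder Matrix

namespace OperatorScaling

/-- The complex `n × n` matrices. -/
abbrev Mat (n : ℕ) : Type := Matrix (Fin n) (Fin n) ℂ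

/-- The adjoint of a linear map on matrices for the Hilbert-Schmidt inner product
`⟨A, B⟩ = tr (Aᴴ * B)`, given by its entries `⟨e_ij, E^* B⟩ = ⟨E e_ij, B⟩` in the basis of
matrix units. -/
def hsAdjoint {n : ℕ} (E : Mat n →ₗ[ℂ] Mat n) : Mat n →ₗ[ℂ] Mat n where
  toFun B := Matrix.of fun i j => Matrix.trace ((E (Matrix.single i j 1))ᴴ * B)
  map_add' B C := by
    ext i j
    simp [Matrix.mul_add]
  map_smul' c B := by
    ext i j
    simp

/-- The defining property of the adjoint. -/
theorem trace_conjTranspose_mul_hsAdjoint {n : ℕ} (E : Mat n →ₗ[ℂ] Mat n) (A B : Mat n) :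
    Matrix.trace (Aᴴ * hsAdjoint E B) = Matrix.trace ((E A)ᴴ * B) := by
  induction A using Matrix.induction_on' with
  | h_zero => simp
  | h_add p q hp hq => simp [Matrix.add_mul, hp, hq]
  | h_std_basis i j x =>
    have h : Matrix.single i j x = x • Matrix.single i j (1 : ℂ) := by simp
    rw [h, map_smul, Matrix.conjTranspose_smul, Matrix.conjTranspose_smul, Matrix.smul_mul,
      Matrix.smul_mul, Matrix.trace_smul, Matrix.trace_smul, Matrix.conjTranspose_single]
    congr 1
    simp [hsAdjoint, Matrix.trace_single_mul]

/-- `E` is doubly stochastic: `E (1) = 1` and `E^* (1) = 1`. -/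
def IsDoublyStochastic {n : ℕ} (E : Mat n →ₗ[ℂ] Mat n) : Prop :=
  E 1 = 1 ∧ hsAdjoint E 1 = 1

/-- `E` is fully indecomposable: if `P`, `Q` are nonzero orthogonal projections of the same rank
with `E (P M_n P) ⊆ Q M_n Q`, then `P = Q = 1`. -/
def IsFullyIndecomposable {n : ℕ} (E : Mat n →ₗ[ℂ] Mat n) : Prop :=
  ∀ P Q : Mat n, IsStarProjection P → IsStarProjection Q → P ≠ 0 → Q ≠ 0 → P.rank = Q.rank →
    (∀ A : Mat n, ∃ B : Mat n, E (P * A * P) = Q * B * Q) → P = 1 ∧ Q = 1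

/-- The scaling `A ↦ Yᴴ * E (X * A * Xᴴ) * Y` of `E` by `X` and `Y`. -/
def scale {n : ℕ} (E : Mat n →ₗ[ℂ] Mat n) (X Y : Mat n) : Mat n →ₗ[ℂ] Mat n where
  toFun A := Yᴴ * E (X * A * Xᴴ) * Y
  map_add' A B := by simp [Matrix.mul_add, Matrix.add_mul]
  map_smul' c A := by simp

end OperatorScaling

open OperatorScaling

namespace OperatorScaling

open Matrix Filter
open scoped Topology

variable {n : ℕ}

/-! Write `S = X Xᴴ` and `R = Y Yᴴ`. Double stochasticity of the scaled map amounts to invertibility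
of `X`, `Y` together with `L S = R⁻¹` and `L* R = S⁻¹`, so the task is to find such positive
definite pairs and to show they are unique up to `(c S, c⁻¹ R)`.

Full indecomposability enters only through rank increase (`rank_lt_rank_map`): a nonzero `A ≥ 0` has
`L A` of full rank or of rank larger than `A`.

Existence: minimize `det (L S) / det S`. This is invariant under `S ↦ a S`. By rank increase and
compactness of the unitary group, it is at least a constant times the ratio of the largest to the
smallest eigenvalue of `S` (`exists_mul_det_le`). Hence only matrices of bounded condition number
compete, and a minimum is attained. The critical point equation there is `L* ((L S)⁻¹) = S⁻¹`.

Uniqueness: given two pairs, take the least `c` with `S' ≤ c S`. The singular matrix `N = c S - S' ≥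
0` and `Z = R' - c⁻¹ R` satisfy `rank Z = rank (L N)` and `rank (L* Z) = rank N`. Since `L*` does
not lower the rank of `Z ≥ 0`, `rank (L N) ≤ rank N`, so rank increase forces `N = 0`. -/

/-! ### Spectral calculus with ordered eigenvalues. -/

/-- The Hermitian matrix `U * diag γ * Uᴴ`. -/
noncomputable def conjDiag (U : Mat n) (γ : Fin n → ℝ) : Mat n :=
  U * diagonal (fun i => (γ i : ℂ)) * Uᴴ

theorem mul_conjTranspose_of_mem_unitaryGroup {U : Mat n} (hU : U ∈ unitaryGroup (Fin n) ℂ) :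
    U * Uᴴ = 1 := mem_unitaryGroup_iff.1 hU

theorem conjTranspose_mul_of_mem_unitaryGroup {U : Mat n} (hU : U ∈ unitaryGroup (Fin n) ℂ) :
    Uᴴ * U = 1 := mem_unitaryGroup_iff'.1 hU

theorem isUnit_of_mem_unitaryGroup {U : Mat n} (hU : U ∈ unitaryGroup (Fin n) ℂ) : IsUnit U :=
  IsUnit.of_mul_eq_one _ (mul_conjTranspose_of_mem_unitaryGroup hU)

theorem isHermitian_conjDiag (U : Mat n) (γ : Fin n → ℝ) : (conjDiag U γ).IsHermitian := by
  apply isHermitian_mul_mul_conjTranspose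
  rw [isHermitian_diagonal_iff]
  intro i
  simp [isSelfAdjoint_iff]

theorem conjDiag_mul {U : Mat n} (hU : U ∈ unitaryGroup (Fin n) ℂ) (a b : Fin n → ℝ) :
    conjDiag U a * conjDiag U b = conjDiag U (a * b) := by
  have : diagonal (fun i => ((a * b) i : ℂ)) =
      diagonal (fun i => (a i : ℂ)) * diagonal (fun i => (b i : ℂ)) := by
    simp [diagonal_mul_diagonal]
  simp only [conjDiag, this]
  calc _ = U * diagonal (fun i => (a i : ℂ)) * (Uᴴ * U) * diagonal (fun i => (b i : ℂ)) * Uᴴ := by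
        simp only [Matrix.mul_assoc]
    _ = _ := by
        rw [conjTranspose_mul_of_mem_unitaryGroup hU]; simp only [Matrix.mul_assoc, Matrix.one_mul]

theorem conjDiag_sub (U : Mat n) (a b : Fin n → ℝ) :
    conjDiag U (a - b) = conjDiag U a - conjDiag U b := by
  have : diagonal (fun i => ((a - b) i : ℂ)) =
      diagonal (fun i => (a i : ℂ)) - diagonal (fun i => (b i : ℂ)) := by
    simp [diagonal_sub]
  simp only [conjDiag, this, Matrix.mul_sub, Matrix.sub_mul]

theorem conjDiag_smul (U : Mat n) (c : ℝ) (a : Fin n → ℝ) :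
    conjDiag U (c • a) = c • conjDiag U a := by
  have : diagonal (fun i => ((c • a) i : ℂ)) = c • diagonal (fun i => (a i : ℂ)) := by
    ext i j
    by_cases h : i = j <;> simp [h, diagonal]
  simp only [conjDiag, this, Matrix.mul_smul, Matrix.smul_mul]

theorem conjDiag_one {U : Mat n} (hU : U ∈ unitaryGroup (Fin n) ℂ) : conjDiag U 1 = 1 := by
  simp [conjDiag, mul_conjTranspose_of_mem_unitaryGroup hU]

theorem posSemidef_conjDiag {U : Mat n} (hU : U ∈ unitaryGroup (Fin n) ℂ) {γ : Fin n → ℝ} :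
    (conjDiag U γ).PosSemidef ↔ ∀ i, 0 ≤ γ i := by
  have := IsUnit.posSemidef_star_right_conjugate_iff (x := diagonal (fun i => (γ i : ℂ)))
    (isUnit_of_mem_unitaryGroup hU)
  rw [conjDiag, ← star_eq_conjTranspose, this, posSemidef_diagonal_iff]
  simp

theorem posDef_conjDiag {U : Mat n} (hU : U ∈ unitaryGroup (Fin n) ℂ) {γ : Fin n → ℝ} :
    (conjDiag U γ).PosDef ↔ ∀ i, 0 < γ i := by
  have := IsUnit.posDef_star_right_conjugate_iff (x := diagonal (fun i => (γ i : ℂ)))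
    (isUnit_of_mem_unitaryGroup hU)
  rw [conjDiag, ← star_eq_conjTranspose, this, posDef_diagonal_iff]
  simp

theorem conjDiag_le_conjDiag {U : Mat n} (hU : U ∈ unitaryGroup (Fin n) ℂ) {a b : Fin n → ℝ}
    (h : ∀ i, a i ≤ b i) : conjDiag U a ≤ conjDiag U b := by
  rw [le_iff, ← conjDiag_sub, posSemidef_conjDiag hU]
  exact fun i => sub_nonneg.2 (h i)

theorem det_conjDiag {U : Mat n} (hU : U ∈ unitaryGroup (Fin n) ℂ) (γ : Fin n → ℝ) :
    (conjDiag U γ).det = ((∏ i, γ i : ℝ) : ℂ) := by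
  rw [conjDiag, det_mul_comm, ← Matrix.mul_assoc, conjTranspose_mul_of_mem_unitaryGroup hU]
  simp

theorem rank_conjDiag {U : Mat n} (hU : U ∈ unitaryGroup (Fin n) ℂ) (γ : Fin n → ℝ) :
    (conjDiag U γ).rank = (Finset.univ.filter fun i => γ i ≠ 0).card := by
  have h1 : IsUnit U.det := (isUnit_iff_isUnit_det _).1 (isUnit_of_mem_unitaryGroup hU)
  have h2 : IsUnit Uᴴ.det := by rw [det_conjTranspose]; exact h1.star
  rw [conjDiag, rank_mul_eq_left_of_isUnit_det _ _ h2, rank_mul_eq_right_of_isUnit_det _ _ h1,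
    rank_diagonal, Fintype.card_subtype]
  simp

theorem trace_conjDiag {U : Mat n} (hU : U ∈ unitaryGroup (Fin n) ℂ) (γ : Fin n → ℝ) :
    (conjDiag U γ).trace = ((∑ i, γ i : ℝ) : ℂ) := by
  rw [conjDiag, trace_mul_comm, ← Matrix.mul_assoc, conjTranspose_mul_of_mem_unitaryGroup hU]
  simp [trace_diagonal]

/-- Spectral theorem with eigenvalues in decreasing order. -/
theorem exists_eq_conjDiag {A : Mat n} (hA : A.IsHermitian) :
    ∃ U ∈ unitaryGroup (Fin n) ℂ, ∃ γ : Fin n → ℝ, Antitone γ ∧ A = conjDiag U γ := by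
  set σ := Tuple.sort (fun i => - hA.eigenvalues i)
  have hσ : Antitone fun i => hA.eigenvalues (σ i) := fun i j hij => by
    have := Tuple.monotone_sort (fun i => - hA.eigenvalues i) hij
    simpa [Function.comp] using this
  set V : Mat n := hA.eigenvectorUnitary.1
  have hV : V ∈ unitaryGroup (Fin n) ℂ := hA.eigenvectorUnitary.2
  refine ⟨V.submatrix id σ, ?_, _, hσ, ?_⟩
  · rw [mem_unitaryGroup_iff, star_eq_conjTranspose, conjTranspose_submatrix,
      submatrix_mul_equiv, mul_conjTranspose_of_mem_unitaryGroup hV, submatrix_id_id]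
  · have h := hA.spectral_theorem
    rw [Unitary.conjStarAlgAut_apply] at h
    have hd : diagonal (fun i => (hA.eigenvalues (σ i) : ℂ)) =
      (diagonal (fun i => (hA.eigenvalues i : ℂ))).submatrix σ σ := by
        rw [submatrix_diagonal_equiv]; rfl
    rw [conjDiag, conjTranspose_submatrix, hd, submatrix_mul_equiv, submatrix_mul_equiv,
      submatrix_id_id]
    exact h

theorem dotProduct_conjDiag_mulVec (U : Mat n) (γ : Fin n → ℝ) (x : Fin n → ℂ) :
    star x ⬝ᵥ conjDiag U γ *ᵥ x = ((∑ i, γ i * ‖(Uᴴ *ᵥ x) i‖ ^ 2 : ℝ) : ℂ) := by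
  have h : star x ᵥ* U = star (Uᴴ *ᵥ x) := by rw [star_mulVec, conjTranspose_conjTranspose]
  rw [conjDiag, ← mulVec_mulVec, ← mulVec_mulVec, dotProduct_mulVec, h, Complex.ofReal_sum]
  refine Finset.sum_congr rfl fun i _ => ?_
  simp only [mulVec_diagonal, Pi.star_apply, RCLike.star_def]
  rw [mul_left_comm, ← Complex.normSq_eq_conj_mul_self, Complex.normSq_eq_norm_sq]
  push_cast
  rfl

/-- Monotonicity of the ordered eigenvalues. -/
theorem le_of_conjDiag_le {U V : Mat n} (hU : U ∈ unitaryGroup (Fin n) ℂ)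
    (hV : V ∈ unitaryGroup (Fin n) ℂ) {ν μ : Fin n → ℝ} (hν : Antitone ν) (hμ : Antitone μ)
    (h : conjDiag U ν ≤ conjDiag V μ) (i : Fin n) : ν i ≤ μ i := by
  -- a vector in the span of the top eigenvectors of one matrix, bottom ones of the other
  let f : ({j // j ≤ i} → ℂ) →ₗ[ℂ] ({j // j < i} → ℂ) :=
    Matrix.toLin' ((Vᴴ * U).submatrix Subtype.val Subtype.val)
  -- There are `i + 1` unknowns against `i` equations, since indices start at `0`.
  have hker : LinearMap.ker f ≠ ⊥ := by
    apply LinearMap.ker_ne_bot_of_finrank_lt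
    simp only [Module.finrank_fintype_fun_eq_card]
    rw [Fintype.card_subtype, Fintype.card_subtype]
    apply Finset.card_lt_card
    refine ⟨fun j hj => ?_, fun hh => ?_⟩
    · simp at hj ⊢; exact hj.le
    · have := hh (by simp : i ∈ _)
      simp at this
  obtain ⟨z, hz, hz0⟩ := (Submodule.ne_bot_iff _).1 hker
  let y : Fin n → ℂ := fun j => if hj : j ≤ i then z ⟨j, hj⟩ else 0
  let w : Fin n → ℂ := (Vᴴ * U) *ᵥ y
  have hy : ∀ j, i < j → y j = 0 := fun j hj => by simp [y, not_le.2 hj]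
  have hw : ∀ j, j < i → w j = 0 := fun j hj => by
    have h1 := congrFun (LinearMap.mem_ker.1 hz) ⟨j, hj⟩
    simp only [f, toLin'_apply, mulVec, dotProduct, submatrix_apply, Pi.zero_apply] at h1
    simp only [w, mulVec, dotProduct]
    rw [← h1, ← Finset.sum_filter_of_ne (p := (· ≤ i)) (fun k _ hk => ?_),
      Finset.sum_subtype (p := (· ≤ i)) (Finset.univ.filter (· ≤ i)) (by simp)]
    · refine Finset.sum_congr rfl fun k _ => ?_
      simp [y, k.2]
    · by_contra hk'
      exact hk (by rw [hy k (not_le.1 hk'), mul_zero])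
  -- `y` and `w` are the coordinates of one vector in two orthonormal bases.
  have hyw : ∑ j, ‖y j‖ ^ 2 = ∑ j, ‖w j‖ ^ 2 := by
    have h1 := dotProduct_conjDiag_mulVec U 1 (U *ᵥ y)
    have h2 := dotProduct_conjDiag_mulVec V 1 (U *ᵥ y)
    rw [conjDiag_one hU] at h1
    rw [conjDiag_one hV, h1, Complex.ofReal_inj] at h2
    simpa [mulVec_mulVec, conjTranspose_mul_of_mem_unitaryGroup hU] using h2
  have hpos : 0 < ∑ j, ‖y j‖ ^ 2 := by
    obtain ⟨j, hj⟩ := Function.ne_iff.1 hz0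
    refine Finset.sum_pos' (fun _ _ => by positivity) ⟨j, Finset.mem_univ _, ?_⟩
    have : y j = z j := by simp [y, j.2]
    rw [this]
    have := norm_pos_iff.2 hj
    positivity
  have hle : ∑ j, ν j * ‖y j‖ ^ 2 ≤ ∑ j, μ j * ‖w j‖ ^ 2 := by
    have h1 := (le_iff.1 h).dotProduct_mulVec_nonneg (U *ᵥ y)
    rw [sub_mulVec, dotProduct_sub, dotProduct_conjDiag_mulVec, dotProduct_conjDiag_mulVec,
      ← Complex.ofReal_sub, Complex.zero_le_real, sub_nonneg] at h1
    simpa [mulVec_mulVec, conjTranspose_mul_of_mem_unitaryGroup hU] using h1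
  have h1 : ν i * ∑ j, ‖y j‖ ^ 2 ≤ ∑ j, ν j * ‖y j‖ ^ 2 := by
    rw [Finset.mul_sum]
    refine Finset.sum_le_sum fun j _ => ?_
    rcases le_or_gt j i with hj | hj
    · exact mul_le_mul_of_nonneg_right (hν hj) (by positivity)
    · simp [hy j hj]
  have h2 : ∑ j, μ j * ‖w j‖ ^ 2 ≤ μ i * ∑ j, ‖w j‖ ^ 2 := by
    rw [Finset.mul_sum]
    refine Finset.sum_le_sum fun j _ => ?_
    rcases lt_or_ge j i with hj | hj
    · simp [hw j hj]
    · exact mul_le_mul_of_nonneg_right (hμ hj) (by positivity)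
  rw [← hyw] at h2
  exact le_of_mul_le_mul_right (h1.trans (hle.trans h2)) hpos

/-! ### Positivity and the Loewner order. -/

theorem exists_le_smul_one {A : Mat n} (hA : A.IsHermitian) :
    ∃ t : ℝ, 0 ≤ t ∧ A ≤ t • (1 : Mat n) := by
  obtain ⟨U, hU, γ, -, rfl⟩ := exists_eq_conjDiag hA
  refine ⟨∑ i, |γ i|, Finset.sum_nonneg fun _ _ => abs_nonneg _, ?_⟩
  rw [← conjDiag_one hU, ← conjDiag_smul]
  refine conjDiag_le_conjDiag hU fun i => ?_
  simpa using (le_abs_self _).trans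
    (Finset.single_le_sum (f := fun i => |γ i|) (fun _ _ => abs_nonneg _) (Finset.mem_univ i))

/-- Linear maps that agree on positive semidefinite matrices are equal. -/
theorem eq_of_forall_posSemidef {M : Type*} [AddCommGroup M] [Module ℂ M] {f g : Mat n →ₗ[ℂ] M}
    (h : ∀ A : Mat n, A.PosSemidef → f A = g A) : f = g := by
  have hherm : ∀ A : Mat n, A.IsHermitian → f A = g A := fun A hA => by
    obtain ⟨t, ht, hle⟩ := exists_le_smul_one hA
    have h1 : A = t • (1 : Mat n) - (t • (1 : Mat n) - A) := by abel
    rw [h1, map_sub f (t • 1), map_sub g (t • 1), h _ (le_iff.1 hle), h _ (PosSemidef.one.smul ht)]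
  ext1 A
  rw [← realPart_add_I_smul_imaginaryPart A, map_add, map_add, map_smul, map_smul,
    hherm _ (realPart A).2, hherm _ (imaginaryPart A).2]

theorem mul_mul_posSemidef {P M : Mat n} (hP : P.IsHermitian) (hM : M.PosSemidef) :
    (P * M * P).PosSemidef := by
  simpa [hP.eq] using hM.mul_mul_conjTranspose_same P

theorem mul_mul_mono {P A B : Mat n} (hP : P.IsHermitian) (h : A ≤ B) :
    P * A * P ≤ P * B * P := by
  rw [le_iff, ← Matrix.sub_mul, ← Matrix.mul_sub]
  exact mul_mul_posSemidef hP h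

/-- If `0 ≤ B ≤ W` then the kernel of `W` is contained in the kernel of `B`. -/
theorem mul_eq_zero_of_le {B W Z : Mat n} (hB : B.PosSemidef) (h : B ≤ W) (hZ : W * Z = 0) :
    B * Z = 0 := by
  refine ext_of_mulVec_single fun i => ?_
  rw [← mulVec_mulVec, zero_mulVec, ← hB.dotProduct_mulVec_zero_iff]
  refine le_antisymm ?_ (hB.dotProduct_mulVec_nonneg _)
  have := (le_iff.1 h).dotProduct_mulVec_nonneg (Z *ᵥ Pi.single i 1)
  rwa [sub_mulVec, mulVec_mulVec _ W, hZ, zero_mulVec, zero_sub, dotProduct_neg,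
    Left.nonneg_neg_iff] at this

/-! ### Full indecomposability implies rank increase. -/

/-- The indicator of the first `s` indices. -/
noncomputable def ind (n s : ℕ) : Fin n → ℝ := fun i => if (i : ℕ) < s then 1 else 0

theorem ind_mul_ind (s : ℕ) : ind n s * ind n s = ind n s := by
  ext i
  by_cases h : (i : ℕ) < s <;> simp [ind, h]

theorem isStarProjection_conjDiag_ind {U : Mat n} (hU : U ∈ unitaryGroup (Fin n) ℂ) (s : ℕ) :
    IsStarProjection (conjDiag U (ind n s)) :=
  ⟨by rw [IsIdempotentElem, conjDiag_mul hU, ind_mul_ind], isHermitian_conjDiag _ _⟩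

theorem rank_conjDiag_ind {U : Mat n} (hU : U ∈ unitaryGroup (Fin n) ℂ) {s : ℕ} (hs : s ≤ n) :
    (conjDiag U (ind n s)).rank = s := by
  rw [rank_conjDiag hU]
  simp [ind, Fin.card_filter_val_lt, hs]

/-- The zeros of a decreasing nonnegative sequence come last. For eigenvalues, the count on the
right is the rank. -/
theorem ne_zero_iff_lt_card {γ : Fin n → ℝ} (hγ : Antitone γ) (h0 : ∀ i, 0 ≤ γ i) (i : Fin n) :
    γ i ≠ 0 ↔ (i : ℕ) < (Finset.univ.filter fun i => γ i ≠ 0).card := by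
  constructor
  · intro hi
    have : Finset.Iic i ⊆ Finset.univ.filter fun i => γ i ≠ 0 := fun j hj => by
      have h1 := hγ (Finset.mem_Iic.1 hj)
      have h2 := (h0 i).lt_of_ne' hi
      simpa using (h2.trans_le h1).ne'
    have := Finset.card_le_card this
    rw [Fin.card_Iic] at this
    omega
  · intro h hi
    have : (Finset.univ.filter fun i => γ i ≠ 0) ⊆ Finset.Iio i := fun j hj => by
      rw [Finset.mem_Iio]
      by_contra! hij
      exact (Finset.mem_filter.1 hj).2 (le_antisymm (hi ▸ hγ hij) (h0 j))
    have := Finset.card_le_card this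
    rw [Fin.card_Iio] at this
    omega

theorem map_le_map {L : Mat n →ₗ[ℂ] Mat n}
    (hL : ∀ A : Mat n, A.PosSemidef → (L A).PosSemidef) {A B : Mat n} (h : A ≤ B) :
    L A ≤ L B := by
  rw [le_iff, ← map_sub]
  exact hL _ h

theorem map_real_smul (L : Mat n →ₗ[ℂ] Mat n) (c : ℝ) (A : Mat n) : L (c • A) = c • L A := by
  rw [← Complex.coe_smul, map_smul, Complex.coe_smul]

/-- A nonzero fully indecomposable positive map increases the rank. -/
theorem rank_lt_rank_map {L : Mat n →ₗ[ℂ] Mat n}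
    (hL : ∀ A : Mat n, A.PosSemidef → (L A).PosSemidef) (hL0 : L ≠ 0)
    (hFI : IsFullyIndecomposable L) {A : Mat n} (hA : A.PosSemidef) (hA0 : A ≠ 0) :
    (L A).rank = n ∨ A.rank < (L A).rank := by
  by_contra! hcon
  obtain ⟨hrn, hle⟩ := hcon
  obtain ⟨U, hU, γ, hγ, hAU⟩ := exists_eq_conjDiag hA.1
  obtain ⟨V, hV, μ, hμ, hEV⟩ := exists_eq_conjDiag (hL A hA).1
  have hγ0 : ∀ i, 0 ≤ γ i := (posSemidef_conjDiag hU).1 (hAU ▸ hA)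
  have hμ0 : ∀ i, 0 ≤ μ i := (posSemidef_conjDiag hV).1 (hEV ▸ hL A hA)
  have hγr := ne_zero_iff_lt_card hγ hγ0
  rw [← rank_conjDiag hU, ← hAU] at hγr
  have hμr := ne_zero_iff_lt_card hμ hμ0
  rw [← rank_conjDiag hV, ← hEV] at hμr
  have hrA : 0 < A.rank := by
    rw [Nat.pos_iff_ne_zero]
    intro h
    apply hA0
    have : γ = 0 := funext fun i => by
      by_contra hi
      have := (hγr i).1 hi
      omega
    rw [hAU, this]
    simp [conjDiag]
  have hAn : A.rank ≤ n := by simpa using A.rank_le_width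
  -- The maximum with `1` keeps the projections nonzero when `L A = 0`.
  set s := max (L A).rank 1 with hs
  have hsA : s ≤ A.rank := max_le hle hrA
  set P := conjDiag U (ind n s) with hP
  set Q := conjDiag V (ind n s) with hQ
  have hPr : P.rank = s := rank_conjDiag_ind hU (hsA.trans hAn)
  have hQr : Q.rank = s := rank_conjDiag_ind hV (hsA.trans hAn)
  have hs0 : s ≠ 0 := by omega
  have hPP : P.IsHermitian := isHermitian_conjDiag _ _
  have hQQ : Q.IsHermitian := isHermitian_conjDiag _ _
  -- `P ≤ c A`
  obtain ⟨c, hc0, hc⟩ : ∃ c : ℝ, 0 ≤ c ∧ P ≤ c • A := by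
    refine ⟨∑ i, (γ i)⁻¹, Finset.sum_nonneg fun i _ => inv_nonneg.2 (hγ0 i), ?_⟩
    rw [hAU, ← conjDiag_smul]
    refine conjDiag_le_conjDiag hU fun i => ?_
    by_cases hi : (i : ℕ) < s
    · have h1 : 0 < γ i := (hγ0 i).lt_of_ne' ((hγr i).2 (hi.trans_le hsA))
      have h2 := Finset.single_le_sum (f := fun i => (γ i)⁻¹) (fun i _ => inv_nonneg.2 (hγ0 i))
        (Finset.mem_univ i)
      have h3 := mul_le_mul_of_nonneg_right h2 h1.le
      simp only [inv_mul_cancel₀ h1.ne'] at h3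
      simpa [ind, hi] using h3
    · simp only [ind, hi, if_false, Pi.smul_apply, smul_eq_mul]
      exact mul_nonneg (Finset.sum_nonneg fun i _ => inv_nonneg.2 (hγ0 i)) (hγ0 i)
  have hker : ∀ M : Mat n, M.PosSemidef → ∃ t : ℝ, 0 ≤ t ∧ L (P * M * P) ≤ t • L A := by
    intro M hM
    obtain ⟨t, ht, hMt⟩ := exists_le_smul_one hM.1
    refine ⟨t * c, by positivity, ?_⟩
    rw [← map_real_smul]
    apply map_le_map hL
    have h1 := mul_mul_mono hPP hMt
    rw [Matrix.mul_smul, Matrix.mul_one, Matrix.smul_mul,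
      (isStarProjection_conjDiag_ind hU s).isIdempotentElem.eq] at h1
    rw [mul_smul]
    exact h1.trans (smul_le_smul_of_nonneg_left hc ht)
  have hAQ : L A * Q = L A := by
    rw [hEV, hQ, conjDiag_mul hV]
    congr 1
    ext i
    by_cases hi : (i : ℕ) < s
    · simp [ind, hi]
    · have : μ i = 0 := by
        by_contra h
        have := (hμr i).1 h
        omega
      simp [this]
  have hAQ' : L A * (1 - Q) = 0 := by rw [Matrix.mul_sub, hAQ, Matrix.mul_one, sub_self]
  -- `L (P M P)` is dominated by a multiple of `L A`, whose range lies in that of `Q`.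
  have hrange : ∀ M : Mat n, M.PosSemidef → L (P * M * P) = Q * L (P * M * P) * Q := by
    intro M hM
    obtain ⟨t, ht, hle⟩ := hker M hM
    have hB : (L (P * M * P)).PosSemidef := hL _ (mul_mul_posSemidef hPP hM)
    have h1 := mul_eq_zero_of_le hB hle (Z := 1 - Q) (by rw [Matrix.smul_mul, hAQ', smul_zero])
    rw [Matrix.mul_sub, Matrix.mul_one, sub_eq_zero] at h1
    have h2 := congrArg conjTranspose h1
    rw [conjTranspose_mul, hB.1.eq, hQQ.eq] at h2
    rw [← h2, ← h1]
  have hall : ∀ M : Mat n, L (P * M * P) = Q * L (P * M * P) * Q := by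
    have := eq_of_forall_posSemidef (n := n)
      (f := L ∘ₗ LinearMap.mulRight ℂ P ∘ₗ LinearMap.mulLeft ℂ P)
      (g := LinearMap.mulRight ℂ Q ∘ₗ LinearMap.mulLeft ℂ Q ∘ₗ L ∘ₗ LinearMap.mulRight ℂ P ∘ₗ
        LinearMap.mulLeft ℂ P) (by simpa using hrange)
    exact fun M => by simpa using LinearMap.congr_fun this M
  have hne : ∀ R : Mat n, R.rank = s → R ≠ 0 := fun R hR h0 => by
    rw [h0, rank_zero] at hR
    omega
  obtain ⟨hP1, hQ1⟩ := hFI P Q (isStarProjection_conjDiag_ind hU s)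
    (isStarProjection_conjDiag_ind hV s) (hne P hPr) (hne Q hQr) (hPr.trans hQr.symm)
    (fun M => ⟨_, hall M⟩)
  -- As `L A` does not have rank `n`, `s = n` is only possible for `L A = 0` and `n = 1`. Since `P =
  -- 1`, every `L M` with `M ≥ 0` is then dominated by `0`.
  have hsn : s = n := by rw [← hPr, hP1]; simp
  have hEA : L A = 0 := by
    have : (L A).rank = 0 := by omega
    have : μ = 0 := funext fun i => by
      by_contra hi
      have := (hμr i).1 hi
      omega
    rw [hEV, this]
    simp [conjDiag]
  apply hL0
  apply eq_of_forall_posSemidef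
  intro M hM
  obtain ⟨t, ht, hle⟩ := hker M hM
  rw [hEA, smul_zero, hP1, Matrix.one_mul, Matrix.mul_one] at hle
  rw [LinearMap.zero_apply]
  exact le_antisymm hle (hL M hM).nonneg

/-! ### Compactness and the minimum of the determinant ratio. -/

theorem isCompact_unitaryGroup : IsCompact (unitaryGroup (Fin n) ℂ : Set (Mat n)) := by
  have hK : IsCompact (Set.univ.pi fun _ : Fin n => Set.univ.pi fun _ : Fin n =>
      Metric.closedBall (0 : ℂ) 1) :=
    isCompact_univ_pi fun _ => isCompact_univ_pi fun _ => isCompact_closedBall _ _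
  refine IsCompact.of_isClosed_subset (X := Mat n) hK ?_ ?_
  · have : (unitaryGroup (Fin n) ℂ : Set (Mat n)) = {U | U * Uᴴ = 1} := by
      ext U
      exact mem_unitaryGroup_iff
    rw [this]
    exact isClosed_eq (by fun_prop) continuous_const
  · intro U hU
    exact fun i _ j _ => mem_closedBall_zero_iff.2 (entry_norm_bound_of_unitary hU i j)

theorem continuous_conjDiag : Continuous fun p : Mat n × (Fin n → ℝ) => conjDiag p.1 p.2 := by
  unfold conjDiag
  have : Continuous fun p : Mat n × (Fin n → ℝ) => diagonal (fun i => (p.2 i : ℂ)) :=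
    Continuous.matrix_diagonal (by fun_prop)
  fun_prop

theorem continuous_conjDiag_left (γ : Fin n → ℝ) : Continuous fun U : Mat n => conjDiag U γ := by
  unfold conjDiag
  fun_prop

theorem continuous_map (L : Mat n →ₗ[ℂ] Mat n) : Continuous L :=
  LinearMap.continuous_of_finiteDimensional L

/-- Hermitian matrices close to `A` are at least `A - ε`. -/
theorem eventually_sub_smul_one_le {A : Mat n} (hA : A.IsHermitian) {ε : ℝ} (hε : 0 < ε) :
    ∀ᶠ B in 𝓝 A, B.IsHermitian → A - ε • (1 : Mat n) ≤ B := by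
  -- The trace of `(B - A)²` is the sum of the squared eigenvalues of `B - A`, so it bounds each of
  -- them.
  have hc : Continuous fun B : Mat n => ((B - A) * (B - A)).trace.re :=
    Complex.continuous_re.comp (Continuous.matrix_trace (by fun_prop))
  have h0 : ((A - A) * (A - A)).trace.re < ε ^ 2 := by simp; positivity
  filter_upwards [hc.continuousAt.eventually_lt_const h0] with B hB hBh
  obtain ⟨U, hU, γ, -, hBA⟩ := exists_eq_conjDiag (hBh.sub hA)
  have h1 : A - ε • (1 : Mat n) ≤ B ↔ -(ε • (1 : Mat n)) ≤ B - A := by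
    rw [neg_le_sub_iff_le_add, sub_le_iff_le_add]
  have h2 : -(ε • (1 : Mat n)) = conjDiag U (-ε • 1) := by
    rw [conjDiag_smul, conjDiag_one hU, neg_smul]
  rw [h1, h2, hBA]
  refine conjDiag_le_conjDiag hU fun i => ?_
  rw [hBA, conjDiag_mul hU, trace_conjDiag hU, Complex.ofReal_re] at hB
  have h3 : γ i * γ i ≤ ∑ i, (γ * γ) i :=
    Finset.single_le_sum (f := fun i => (γ * γ) i) (fun i _ => mul_self_nonneg _)
      (Finset.mem_univ i)
  have h4 : |γ i| ≤ ε := abs_le_of_sq_le_sq (by nlinarith) hε.le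
  simpa using (abs_le.1 h4).1

/-- The property of increasing the rank of singular nonzero positive semidefinite matrices. -/
def IsRankIncreasing (L : Mat n →ₗ[ℂ] Mat n) : Prop :=
  ∀ A : Mat n, A.PosSemidef → A ≠ 0 → (L A).rank = n ∨ A.rank < (L A).rank

/-- For a projection of rank `s ≥ i`, the image has rank `n` or more than `s`, so its eigenvalue
number `i`, counted from `0`, is positive. Half of it is a lower bound near each unitary, and
compactness makes the bound uniform. -/
theorem exists_pos_le_eigenvalue {L : Mat n →ₗ[ℂ] Mat n}
    (hL : ∀ A : Mat n, A.PosSemidef → (L A).PosSemidef) (hr : IsRankIncreasing L)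
    (i : Fin n) {s : ℕ} (hs : 1 ≤ s) (hsn : s ≤ n) (his : (i : ℕ) ≤ s) :
    ∃ δ : ℝ, 0 < δ ∧ ∀ U ∈ unitaryGroup (Fin n) ℂ, ∀ V ∈ unitaryGroup (Fin n) ℂ,
      ∀ μ : Fin n → ℝ, Antitone μ → L (conjDiag U (ind n s)) = conjDiag V μ → δ ≤ μ i := by
  suffices h : ∃ δ : ℝ, 0 < δ ∧ ∀ U ∈ (unitaryGroup (Fin n) ℂ : Set (Mat n)),
      U ∈ unitaryGroup (Fin n) ℂ → ∀ V ∈ unitaryGroup (Fin n) ℂ,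
      ∀ μ : Fin n → ℝ, Antitone μ → L (conjDiag U (ind n s)) = conjDiag V μ → δ ≤ μ i by
    obtain ⟨δ, h0, h⟩ := h
    exact ⟨δ, h0, fun U hU => h U hU hU⟩
  refine isCompact_unitaryGroup.induction_on (p := fun K => ∃ δ : ℝ, 0 < δ ∧ ∀ U ∈ K,
      U ∈ unitaryGroup (Fin n) ℂ → ∀ V ∈ unitaryGroup (Fin n) ℂ,
      ∀ μ : Fin n → ℝ, Antitone μ → L (conjDiag U (ind n s)) = conjDiag V μ → δ ≤ μ i)
    ⟨1, one_pos, by simp⟩ ?_ ?_ ?_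
  · rintro K K' hKK' ⟨δ, h0, h⟩
    exact ⟨δ, h0, fun U hU => h U (hKK' hU)⟩
  · rintro K K' ⟨δ, h0, h⟩ ⟨δ', h0', h'⟩
    refine ⟨min δ δ', lt_min h0 h0', ?_⟩
    rintro U (hU | hU) hU' V hV μ hμ he
    · exact (min_le_left _ _).trans (h U hU hU' V hV μ hμ he)
    · exact (min_le_right _ _).trans (h' U hU hU' V hV μ hμ he)
  · intro U hU
    have hind : ∀ i, 0 ≤ ind n s i := fun i => by unfold ind; split_ifs <;> norm_num
    have hpsd : ∀ U ∈ unitaryGroup (Fin n) ℂ, (L (conjDiag U (ind n s))).PosSemidef :=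
      fun U hU => hL _ ((posSemidef_conjDiag hU).2 hind)
    obtain ⟨V, hV, μ, hμ, he⟩ := exists_eq_conjDiag (hpsd U hU).1
    have hμ0 : ∀ i, 0 ≤ μ i := (posSemidef_conjDiag hV).1 (he ▸ hpsd U hU)
    have hμi : 0 < μ i := by
      refine (hμ0 i).lt_of_ne' ?_
      rw [ne_zero_iff_lt_card hμ hμ0, ← rank_conjDiag hV, ← he]
      have hrk := rank_conjDiag_ind hU hsn
      have hne : conjDiag U (ind n s) ≠ 0 := fun h => by
        rw [h, rank_zero] at hrk
        omega
      rcases hr _ ((posSemidef_conjDiag hU).2 hind) hne with h | h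
      · rw [h]; exact i.2
      · omega
    have hcont : Continuous fun U : Mat n => L (conjDiag U (ind n s)) :=
      (continuous_map L).comp (continuous_conjDiag_left _)
    have hev := (hcont.tendsto U).eventually
      (eventually_sub_smul_one_le (hpsd U hU).1 (half_pos hμi))
    refine ⟨_, mem_nhdsWithin_of_mem_nhds hev, μ i / 2, half_pos hμi, ?_⟩
    intro U' hU' hU'' V' hV' μ' hμ' he'
    have h1 := hU' (hpsd U' hU'').1
    rw [he, he', ← conjDiag_one hV, ← conjDiag_smul, ← conjDiag_sub] at h1
    have h2 := le_of_conjDiag_le hV hV' (fun a b hab => by simpa using hμ hab) hμ' h1 i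
    simp at h2
    linarith

/-- Dividing by the last eigenvalue and the determinant of `S = conjDiag U γ` bounds `det (L S) /
det S` below by `c` times the condition number of `S`. The gain comes from a shift of index:
eigenvalue `i + 1` of `L S` is already controlled by eigenvalue `i` of `S`. -/
theorem exists_mul_det_le {m : ℕ} {L : Mat (m + 1) →ₗ[ℂ] Mat (m + 1)}
    (hL : ∀ A : Mat (m + 1), A.PosSemidef → (L A).PosSemidef) (hr : IsRankIncreasing L) :
    ∃ c : ℝ, 0 < c ∧ ∀ U ∈ unitaryGroup (Fin (m + 1)) ℂ, ∀ γ : Fin (m + 1) → ℝ, Antitone γ →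
      (∀ i, 0 < γ i) →
        c * (γ 0 * ∏ i, γ i) ≤ γ (Fin.last m) * (L (conjDiag U γ)).det.re := by
  choose δ hδ hδμ using fun i : Fin (m + 1) => exists_pos_le_eigenvalue hL hr i
    (s := max (i : ℕ) 1) (le_max_right _ _) (by omega) (le_max_left _ _)
  refine ⟨∏ i, δ i, Finset.prod_pos fun i _ => hδ i, fun U hU γ hγ hγ0 => ?_⟩
  -- `g` sends `0` to `0` and `k + 1` to `k`; a projection onto the first `max i 1` eigenvectors,
  -- times `γ (g i)`, lies below `conjDiag U γ`.
  let g : Fin (m + 1) → Fin (m + 1) := Fin.cases 0 Fin.castSucc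
  have hg : ∀ i j : Fin (m + 1), (j : ℕ) < max (i : ℕ) 1 → j ≤ g i := by
    intro i j
    refine Fin.cases ?_ (fun k => ?_) i
    · intro h
      rw [Fin.le_def]
      simp at h
      simp [g, h]
    · intro h
      rw [Fin.le_def]
      simp [g] at h ⊢
      omega
  have hpsd := hL _ ((posSemidef_conjDiag hU).2 fun i => (hγ0 i).le)
  obtain ⟨V, hV, μ, hμ, he⟩ := exists_eq_conjDiag hpsd.1
  have hle : ∀ i, δ i * γ (g i) ≤ μ i := by
    intro i
    have hP : (conjDiag U (ind (m + 1) (max (i : ℕ) 1))).PosSemidef :=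
      (posSemidef_conjDiag hU).2 fun i => by unfold ind; split_ifs <;> norm_num
    obtain ⟨V', hV', μ', hμ', he'⟩ := exists_eq_conjDiag (hL _ hP).1
    have h1 : γ (g i) • conjDiag U (ind (m + 1) (max (i : ℕ) 1)) ≤ conjDiag U γ := by
      rw [← conjDiag_smul]
      refine conjDiag_le_conjDiag hU fun j => ?_
      by_cases hj : (j : ℕ) < max (i : ℕ) 1
      · simp only [ind, hj, if_true, Pi.smul_apply, smul_eq_mul, mul_one]
        exact hγ (hg i j hj)
      · simp only [ind, hj, if_false, Pi.smul_apply, smul_eq_mul, mul_zero]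
        exact (hγ0 j).le
    have h2 := map_le_map hL h1
    rw [map_real_smul, he, he', ← conjDiag_smul] at h2
    have h3 := le_of_conjDiag_le hV' hV
      (fun a b hab => mul_le_mul_of_nonneg_left (hμ' hab) (hγ0 _).le) hμ h2 i
    have h4 := hδμ i U hU V' hV' μ' hμ' he'
    have h5 := mul_le_mul_of_nonneg_right h4 (hγ0 (g i)).le
    have h6 : γ (g i) * μ' i ≤ μ i := h3
    linarith
  have hprod : (∏ i, δ i) * ∏ i, γ (g i) ≤ ∏ i, μ i := by
    rw [← Finset.prod_mul_distrib]
    exact Finset.prod_le_prod (fun i _ => mul_nonneg (hδ i).le (hγ0 _).le) fun i _ => hle i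
  -- Shifting the index repeats `γ 0` and drops the last eigenvalue.
  have hgprod : γ (Fin.last m) * ∏ i, γ (g i) = γ 0 * ∏ i, γ i := by
    rw [Fin.prod_univ_succ, Fin.prod_univ_castSucc γ]
    simp only [g, Fin.cases_zero, Fin.cases_succ]
    ring
  rw [he, det_conjDiag hV, Complex.ofReal_re, ← hgprod]
  calc _ = γ (Fin.last m) * ((∏ i, δ i) * ∏ i, γ (g i)) := by ring
    _ ≤ _ := mul_le_mul_of_nonneg_left hprod (hγ0 _).le

theorem re_det_smul (c : ℝ) (A : Mat n) : (c • A).det.re = c ^ n * A.det.re := by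
  rw [← Complex.coe_smul, det_smul, Fintype.card_fin, ← Complex.ofReal_pow, Complex.re_ofReal_mul]

theorem posDef_of_rank_eq {A : Mat n} (hA : A.PosSemidef) (h : A.rank = n) : A.PosDef := by
  obtain ⟨V, hV, μ, hμ, rfl⟩ := exists_eq_conjDiag hA.1
  have hμ0 : ∀ i, 0 ≤ μ i := (posSemidef_conjDiag hV).1 hA
  rw [posDef_conjDiag hV]
  intro i
  refine (hμ0 i).lt_of_ne' ?_
  rw [ne_zero_iff_lt_card hμ hμ0, ← rank_conjDiag hV, h]
  exact i.2

theorem posDef_map_of_isRankIncreasing {L : Mat n →ₗ[ℂ] Mat n}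
    (hL : ∀ A : Mat n, A.PosSemidef → (L A).PosSemidef) (hr : IsRankIncreasing L)
    {A : Mat n} (hA : A.PosDef) : (L A).PosDef := by
  have hrk : A.rank = n := by rw [rank_of_isUnit _ hA.isUnit, Fintype.card_fin]
  have hle : (L A).rank ≤ n := by simpa using (L A).rank_le_width
  refine posDef_of_rank_eq (hL A hA.posSemidef) (le_antisymm hle ?_)
  by_cases h0 : A = 0
  · rw [h0, rank_zero] at hrk
    omega
  · rcases hr A hA.posSemidef h0 with h | h <;> omega

theorem exists_conjDiag_forall_le {F : Mat n → ℝ} {K : Set (Mat n × (Fin n → ℝ))}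
    (hK : IsCompact K) (hne : K.Nonempty) (hKpos : ∀ p ∈ K, (conjDiag p.1 p.2).PosDef)
    (hF : ContinuousOn F {T | T.PosDef}) :
    ∃ p ∈ K, ∀ q ∈ K, F (conjDiag p.1 p.2) ≤ F (conjDiag q.1 q.2) := by
  have hc : ContinuousOn (F ∘ fun p : Mat n × (Fin n → ℝ) => conjDiag p.1 p.2) K :=
    hF.comp continuous_conjDiag.continuousOn hKpos
  obtain ⟨p, hp, hmin⟩ := hK.exists_isMinOn hne hc
  exact ⟨p, hp, fun q hq => isMinOn_iff.1 hmin q hq⟩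

theorem exists_forall_conjDiag_le {F : Mat n → ℝ} (hF : ContinuousOn F {T | T.PosDef}) {ε : ℝ}
    (hε0 : 0 < ε) (hε1 : ε ≤ 1) :
    ∃ S : Mat n, S.PosDef ∧ ∀ U ∈ unitaryGroup (Fin n) ℂ, ∀ γ : Fin n → ℝ,
      (∀ i, ε ≤ γ i) → (∀ i, γ i ≤ 1) → F S ≤ F (conjDiag U γ) := by
  obtain ⟨p, hp, hmin⟩ := exists_conjDiag_forall_le
    (K := (unitaryGroup (Fin n) ℂ : Set (Mat n)) ×ˢ Set.Icc (fun _ : Fin n => ε) (fun _ => 1))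
    (isCompact_unitaryGroup.prod isCompact_Icc)
    ⟨((1 : Mat n), fun _ => 1), Set.mk_mem_prod (one_mem (unitaryGroup (Fin n) ℂ))
      ⟨fun _ => hε1, le_rfl⟩⟩
    (fun p hp => (posDef_conjDiag hp.1).2 fun i => hε0.trans_le (hp.2.1 i)) hF
  refine ⟨conjDiag p.1 p.2, (posDef_conjDiag hp.1).2 fun i => hε0.trans_le (hp.2.1 i), ?_⟩
  intro U hU γ h1 h2
  exact hmin (U, γ) (Set.mk_mem_prod hU ⟨h1, h2⟩)

/-- The infimum of `det (L S) / det S` over positive definite `S` is attained. -/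
theorem exists_posDef_forall_det_le {m : ℕ} {L : Mat (m + 1) →ₗ[ℂ] Mat (m + 1)}
    (hL : ∀ A : Mat (m + 1), A.PosSemidef → (L A).PosSemidef) (hr : IsRankIncreasing L) :
    ∃ S : Mat (m + 1), S.PosDef ∧ ∀ T : Mat (m + 1), T.PosDef →
      (L S).det.re / S.det.re ≤ (L T).det.re / T.det.re := by
  obtain ⟨c, hc, hbound⟩ := exists_mul_det_le hL hr
  let F : Mat (m + 1) → ℝ := fun S => (L S).det.re / S.det.re
  have hdet : ∀ T : Mat (m + 1), T.PosDef → 0 < T.det.re := fun T hT =>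
    (Complex.pos_iff.1 hT.det_pos).1
  have hFsmul : ∀ (a : ℝ) (S : Mat (m + 1)), a ≠ 0 → F (a • S) = F S := by
    intro a S ha
    simp only [F]
    rw [map_real_smul, re_det_smul, re_det_smul, mul_div_mul_left _ _ (pow_ne_zero _ ha)]
  have h1U : (1 : Mat (m + 1)) ∈ unitaryGroup (Fin (m + 1)) ℂ := one_mem _
  have hB : c ≤ F 1 := by
    have := hbound 1 h1U 1 (fun _ _ _ => le_rfl) (fun _ => one_pos)
    rw [conjDiag_one h1U] at this
    simpa [F] using this
  have hB0 : 0 < F 1 := hc.trans_le hB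
  -- If `F T < F 1`, the bound gives `c γ 0 ≤ F 1 * γ (last m)`; after dividing by `γ 0` all
  -- eigenvalues lie in `[ε, 1]`.
  set ε := c / F 1 with hε
  have hε0 : 0 < ε := div_pos hc hB0
  have hε1 : ε ≤ 1 := (div_le_one hB0).2 hB
  have hdetc : Continuous fun S : Mat (m + 1) => S.det.re :=
    Complex.continuous_re.comp (Continuous.matrix_det continuous_id)
  have hFc : ContinuousOn F {T | T.PosDef} :=
    ContinuousOn.div (hdetc.comp (continuous_map L)).continuousOn hdetc.continuousOn
      fun T hT => (hdet T hT).ne'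
  obtain ⟨S, hS, hmin⟩ := exists_forall_conjDiag_le hFc hε0 hε1
  refine ⟨S, hS, fun T hT => ?_⟩
  change F _ ≤ F T
  have h1 : F S ≤ F 1 := by
    have := hmin 1 h1U 1 (fun _ => hε1) (fun _ => le_rfl)
    rwa [conjDiag_one h1U] at this
  rcases le_or_gt (F 1) (F T) with hT1 | hT1
  · exact h1.trans hT1
  obtain ⟨U, hU, γ, hγ, rfl⟩ := exists_eq_conjDiag hT.1
  have hγ0 := (posDef_conjDiag hU).1 hT
  have hεγ : ε * γ 0 ≤ γ (Fin.last m) := by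
    have h2 := hbound U hU γ hγ hγ0
    have h3 : (∏ i, γ i) = (conjDiag U γ).det.re := by rw [det_conjDiag hU, Complex.ofReal_re]
    have h4 : (L (conjDiag U γ)).det.re < F 1 * (conjDiag U γ).det.re :=
      (div_lt_iff₀ (hdet _ hT)).1 hT1
    rw [h3] at h2
    have h5 : c * γ 0 * (conjDiag U γ).det.re ≤
        γ (Fin.last m) * F 1 * (conjDiag U γ).det.re := by
      have := mul_le_mul_of_nonneg_left h4.le (hγ0 (Fin.last m)).le
      linarith
    have h6 := le_of_mul_le_mul_right h5 (hdet _ hT)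
    rw [hε, div_mul_eq_mul_div, div_le_iff₀ hB0]
    exact h6
  have h7 := hmin U hU ((γ 0)⁻¹ • γ) (fun i => ?_) (fun i => ?_)
  · rwa [conjDiag_smul, hFsmul _ _ (inv_ne_zero (hγ0 0).ne')] at h7
  · simp only [Pi.smul_apply, smul_eq_mul]
    rw [inv_mul_eq_div, le_div_iff₀ (hγ0 0)]
    exact hεγ.trans (hγ (Fin.le_last i))
  · simp only [Pi.smul_apply, smul_eq_mul]
    rw [inv_mul_eq_div, div_le_one (hγ0 0)]
    exact hγ (Fin.zero_le i)

/-! ### The critical point equation. -/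

theorem hasDerivAt_re_det_one_add_smul (M : Mat n) :
    HasDerivAt (fun t : ℝ => (1 + t • M).det.re) M.trace.re 0 := by
  have h : HasDerivAt (fun z : ℂ => (1 + z • M).det) M.trace ((0 : ℝ) : ℂ) := by
    rw [funext fun z : ℂ => det_one_add_smul z M]
    set q := (det (1 + (Polynomial.X : Polynomial ℂ) • M.map Polynomial.C)).divX.divX
    have h1 := ((hasDerivAt_id (((0 : ℝ) : ℂ))).const_mul M.trace).const_add 1
    have h2 := (q.hasDerivAt ((0 : ℝ) : ℂ)).mul (hasDerivAt_pow 2 ((0 : ℝ) : ℂ))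
    convert! h1.add h2 using 1
    simp
  simpa only [Complex.coe_smul] using h.real_of_complex

theorem posDef_eventually {S H : Mat n} (hS : S.PosDef) (hH : H.IsHermitian) :
    ∀ᶠ t : ℝ in 𝓝 0, (S + t • H).PosDef := by
  obtain ⟨U, hU, γ, hγ, rfl⟩ := exists_eq_conjDiag hS.1
  have hγ0 := (posDef_conjDiag hU).1 hS
  obtain ⟨ε, hε, hεγ⟩ : ∃ ε : ℝ, 0 < ε ∧ ∀ i, ε < γ i := by
    obtain ⟨ε, hε, h⟩ := Pi.exists_forall_pos_add_lt (x := 0) hγ0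
    exact ⟨ε, hε, fun i => by simpa using h i⟩
  have hc : Tendsto (fun t : ℝ => conjDiag U γ + t • H) (𝓝 0) (𝓝 (conjDiag U γ)) := by
    have : Continuous fun t : ℝ => conjDiag U γ + t • H := by fun_prop
    simpa using this.tendsto 0
  filter_upwards [hc.eventually (eventually_sub_smul_one_le hS.1 hε)] with t ht
  have h1 := ht (hS.1.add (hH.smul (by simp [isSelfAdjoint_iff])))
  have h2 : (conjDiag U γ - ε • (1 : Mat n)).PosDef := by
    rw [← conjDiag_one hU, ← conjDiag_smul, ← conjDiag_sub, posDef_conjDiag hU]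
    intro i
    simpa using hεγ i
  simpa using h2.add_posSemidef (le_iff.1 h1)

theorem conj_trace_mul {A B : Mat n} (hA : A.IsHermitian) (hB : B.IsHermitian) :
    star (A * B).trace = (A * B).trace := by
  rw [← trace_conjTranspose, conjTranspose_mul, hA.eq, hB.eq, trace_mul_comm]

/-- A minimizer of `det (L S) / det S` gives a scaling to a doubly stochastic map. -/
theorem exists_scaling_pair {m : ℕ} {L : Mat (m + 1) →ₗ[ℂ] Mat (m + 1)}
    (hL : ∀ A : Mat (m + 1), A.PosSemidef → (L A).PosSemidef) (hr : IsRankIncreasing L) :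
    ∃ S R : Mat (m + 1), S.PosDef ∧ R.PosDef ∧ L S = R⁻¹ ∧ hsAdjoint L R = S⁻¹ := by
  obtain ⟨S, hS, hmin⟩ := exists_posDef_forall_det_le hL hr
  have hLS := posDef_map_of_isRankIncreasing hL hr hS
  have hherm : ∀ A : Mat (m + 1), A.IsHermitian → (L A).IsHermitian := by
    intro A hA
    obtain ⟨t, ht, hle⟩ := exists_le_smul_one hA
    have h1 : A = t • (1 : Mat (m + 1)) - (t • (1 : Mat (m + 1)) - A) := by abel
    rw [h1, map_sub L (t • 1)]
    exact (hL _ (PosSemidef.one.smul ht)).1.sub (hL _ (le_iff.1 hle)).1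
  have hfactor : ∀ (A B : Mat (m + 1)) (t : ℝ), A.PosDef →
      (A + t • B).det.re = A.det.re * (1 + t • (A⁻¹ * B)).det.re := by
    intro A B t hA
    have h1 : A + t • B = A * (1 + t • (A⁻¹ * B)) := by
      rw [Matrix.mul_add, Matrix.mul_one, Matrix.mul_smul,
        mul_nonsing_inv_cancel_left _ _ ((isUnit_iff_isUnit_det _).1 hA.isUnit)]
    have h2 : (A.det.re : ℂ) = A.det := by
      apply Complex.ext
      · simp
      · simpa using (Complex.pos_iff.1 hA.det_pos).2
    rw [h1, det_mul, ← h2, Complex.re_ofReal_mul, Complex.ofReal_re]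
  have hcrit : ∀ H : Mat (m + 1), H.IsHermitian →
      ((L S)⁻¹ * L H).trace = (S⁻¹ * H).trace := by
    intro H hH
    have hd0 : 0 < S.det.re := (Complex.pos_iff.1 hS.det_pos).1
    have he0 : 0 < (L S).det.re := (Complex.pos_iff.1 hLS.det_pos).1
    -- Clearing denominators turns minimality of the quotient into nonnegativity of this difference,
    -- which vanishes at `0`.
    have hlocal : IsLocalMin (fun t : ℝ => (1 + t • ((L S)⁻¹ * L H)).det.re -
        (1 + t • (S⁻¹ * H)).det.re) 0 := by
      filter_upwards [posDef_eventually hS hH] with t ht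
      have h1 := hmin _ ht
      have h2 : 0 < (S + t • H).det.re := (Complex.pos_iff.1 ht.det_pos).1
      rw [div_le_div_iff₀ hd0 h2, map_add, map_real_smul, hfactor _ _ _ hS,
        hfactor _ _ _ hLS] at h1
      have h3 : (L S).det.re * S.det.re * (1 + t • (S⁻¹ * H)).det.re ≤
          (L S).det.re * S.det.re * (1 + t • ((L S)⁻¹ * L H)).det.re := by linarith
      have h4 := le_of_mul_le_mul_left h3 (mul_pos he0 hd0)
      simpa using h4
    have hder := hlocal.hasDerivAt_eq_zero
      ((hasDerivAt_re_det_one_add_smul _).sub (hasDerivAt_re_det_one_add_smul _))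
    apply Complex.ext
    · linarith
    · rw [Complex.conj_eq_iff_im.1 (conj_trace_mul hLS.inv.1 (hherm H hH)),
        Complex.conj_eq_iff_im.1 (conj_trace_mul hS.inv.1 hH)]
  refine ⟨S, (L S)⁻¹, hS, hLS.inv, ?_, ?_⟩
  · rw [nonsing_inv_nonsing_inv _ ((isUnit_iff_isUnit_det _).1 hLS.isUnit)]
  -- Linearity extends the critical equation to all matrices; nondegeneracy of the trace pairing
  -- then identifies `L* ((L S)⁻¹)`.
  · have hlin := eq_of_forall_posSemidef (n := m + 1)
      (f := traceLinearMap (Fin (m + 1)) ℂ ℂ ∘ₗ LinearMap.mulLeft ℂ (L S)⁻¹ ∘ₗ L)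
      (g := traceLinearMap (Fin (m + 1)) ℂ ℂ ∘ₗ LinearMap.mulLeft ℂ S⁻¹)
      (fun A hA => by simpa using hcrit A hA.1)
    refine ext_iff_trace_mul_left.2 fun A => ?_
    have h1 := congrArg star (LinearMap.congr_fun hlin Aᴴ)
    simp only [LinearMap.comp_apply, LinearMap.mulLeft_apply, traceLinearMap_apply,
      ← trace_conjTranspose, conjTranspose_mul, hLS.inv.1.eq, hS.inv.1.eq,
      conjTranspose_conjTranspose] at h1
    have h2 := trace_conjTranspose_mul_hsAdjoint L Aᴴ (L S)⁻¹
    rw [conjTranspose_conjTranspose] at h2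
    exact h2.trans h1

/-! ### Uniqueness of the pair `(S, R)`. -/

theorem exists_conjTranspose_mul_self {A : Mat n} (hA : A.PosSemidef) :
    ∃ X : Mat n, A = Xᴴ * X := by
  obtain ⟨U, hU, γ, -, rfl⟩ := exists_eq_conjDiag hA.1
  have h0 := (posSemidef_conjDiag hU).1 hA
  refine ⟨conjDiag U fun i => √(γ i), ?_⟩
  rw [(isHermitian_conjDiag _ _).eq, conjDiag_mul hU]
  congr 1
  ext i
  simp [Real.mul_self_sqrt (h0 i)]

theorem exists_posDef_mul_self {A : Mat n} (hA : A.PosDef) :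
    ∃ X : Mat n, X.PosDef ∧ X * X = A := by
  obtain ⟨U, hU, γ, -, rfl⟩ := exists_eq_conjDiag hA.1
  have h0 := (posDef_conjDiag hU).1 hA
  refine ⟨conjDiag U fun i => √(γ i), (posDef_conjDiag hU).2 fun i => Real.sqrt_pos.2 (h0 i), ?_⟩
  rw [conjDiag_mul hU]
  congr 1
  ext i
  simp [Real.mul_self_sqrt (h0 i).le]

/-- With `A = Xᴴ X` and `B = Yᴴ Y` the trace is the squared Hilbert-Schmidt norm of `Y Xᴴ`. -/
theorem mul_eq_zero_of_trace_mul_eq_zero {A B : Mat n} (hA : A.PosSemidef) (hB : B.PosSemidef)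
    (h : (A * B).trace = 0) : B * A = 0 := by
  obtain ⟨X, rfl⟩ := exists_conjTranspose_mul_self hA
  obtain ⟨Y, rfl⟩ := exists_conjTranspose_mul_self hB
  have h1 : ((Y * Xᴴ)ᴴ * (Y * Xᴴ)).trace = 0 := by
    rw [← h, conjTranspose_mul, conjTranspose_conjTranspose, Matrix.mul_assoc Xᴴ,
      trace_mul_comm Xᴴ]
    simp only [Matrix.mul_assoc]
  have h2 := trace_conjTranspose_mul_self_eq_zero_iff.1 h1
  calc Yᴴ * Y * (Xᴴ * X) = Yᴴ * (Y * Xᴴ) * X := by simp only [Matrix.mul_assoc]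
    _ = 0 := by rw [h2]; simp

/-- Let `P` be the projection onto the kernel of `L* Z`. Then `L P` is orthogonal to `Z`, so `rank
(L P) ≤ n - rank Z`. If the rank dropped, this would be less than `rank P`, against rank increase.
-/
theorem rank_le_rank_hsAdjoint {L : Mat n →ₗ[ℂ] Mat n}
    (hL : ∀ A : Mat n, A.PosSemidef → (L A).PosSemidef) (hr : IsRankIncreasing L)
    {Z : Mat n} (hZ : Z.PosSemidef) (hW : (hsAdjoint L Z).IsHermitian) :
    Z.rank ≤ (hsAdjoint L Z).rank := by
  by_contra! hlt
  obtain ⟨U, hU, γ, -, he⟩ := exists_eq_conjDiag hW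
  set p : Fin n → ℝ := fun i => if γ i = 0 then 1 else 0 with hp
  have hP : (conjDiag U p).PosSemidef :=
    (posSemidef_conjDiag hU).2 fun i => by simp only [hp]; split_ifs <;> norm_num
  have hrank : (conjDiag U p).rank + (hsAdjoint L Z).rank = n := by
    rw [he, rank_conjDiag hU, rank_conjDiag hU]
    have := Finset.card_filter_add_card_filter_not (s := (Finset.univ : Finset (Fin n)))
      (fun i => γ i = 0)
    simpa [hp] using this
  have h0 : (L (conjDiag U p) * Z).trace = 0 := by
    have h1 := trace_conjTranspose_mul_hsAdjoint L (conjDiag U p) Z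
    rw [hP.1.eq, (hL _ hP).1.eq] at h1
    rw [← h1, he, conjDiag_mul hU]
    have : p * γ = 0 := by
      ext i
      by_cases h : γ i = 0 <;> simp [hp, h]
    rw [this]
    simp [conjDiag]
  have h1 := rank_add_rank_le_card_of_mul_eq_zero
    (mul_eq_zero_of_trace_mul_eq_zero (hL _ hP) hZ h0)
  rw [Fintype.card_fin] at h1
  have hne : conjDiag U p ≠ 0 := fun h => by
    rw [h, rank_zero] at hrank
    omega
  rcases hr _ hP hne with h | h <;> omega

theorem rank_mul_mul_of_isUnit {A B C : Mat n} (hA : IsUnit A) (hC : IsUnit C) :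
    (A * B * C).rank = B.rank := by
  rw [rank_mul_eq_left_of_isUnit_det _ _ ((isUnit_iff_isUnit_det _).1 hC),
    rank_mul_eq_right_of_isUnit_det _ _ ((isUnit_iff_isUnit_det _).1 hA)]

/-- The least `c` with `S' ≤ c S`. -/
theorem exists_singular_sub {m : ℕ} {S S' : Mat (m + 1)} (hS : S.PosDef) (hS' : S'.PosDef) :
    ∃ c : ℝ, 0 < c ∧ (c • S - S').PosSemidef ∧ ¬ IsUnit (c • S - S') := by
  obtain ⟨X, hX, rfl⟩ := exists_posDef_mul_self hS
  have hdet := (isUnit_iff_isUnit_det _).1 hX.isUnit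
  have hM : (X⁻¹ * S' * X⁻¹).PosDef := by
    have := (IsUnit.posDef_star_right_conjugate_iff (x := S') hX.inv.isUnit).2 hS'
    rwa [star_eq_conjTranspose, hX.inv.1.eq] at this
  -- The least `c` is the largest eigenvalue `γ 0` of `X⁻¹ S' X⁻¹`.
  obtain ⟨U, hU, γ, hγ, he⟩ := exists_eq_conjDiag hM.1
  have hγ0 := (posDef_conjDiag hU).1 (he ▸ hM)
  have h1 : γ 0 • (X * X) - S' = X * conjDiag U (γ 0 • 1 - γ) * X := by
    rw [conjDiag_sub, ← he, conjDiag_smul, conjDiag_one hU, Matrix.mul_sub, Matrix.sub_mul]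
    congr 1
    · simp
    · simp only [Matrix.mul_assoc]
      rw [nonsing_inv_mul _ hdet, Matrix.mul_one, mul_nonsing_inv_cancel_left _ _ hdet]
  refine ⟨γ 0, hγ0 0, ?_, ?_⟩
  · rw [h1]
    refine mul_mul_posSemidef hX.1 ((posSemidef_conjDiag hU).2 fun i => ?_)
    simpa using hγ (Fin.zero_le i)
  · rw [h1, isUnit_iff_isUnit_det, det_mul, det_mul, det_conjDiag hU,
      Finset.prod_eq_zero (Finset.mem_univ 0) (by simp)]
    simp

/-- Uniqueness of the scaling pair. -/
theorem scaling_pair_unique {m : ℕ} {L : Mat (m + 1) →ₗ[ℂ] Mat (m + 1)}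
    (hL : ∀ A : Mat (m + 1), A.PosSemidef → (L A).PosSemidef) (hr : IsRankIncreasing L)
    {S R S' R' : Mat (m + 1)} (hS : S.PosDef) (hR : R.PosDef) (hS' : S'.PosDef) (hR' : R'.PosDef)
    (h1 : L S = R⁻¹) (h2 : hsAdjoint L R = S⁻¹) (h1' : L S' = R'⁻¹)
    (h2' : hsAdjoint L R' = S'⁻¹) :
    ∃ c : ℝ, 0 < c ∧ S' = c • S ∧ R' = c⁻¹ • R := by
  obtain ⟨c, hc, hN, hNu⟩ := exists_singular_sub hS hS'
  have hRd := (isUnit_iff_isUnit_det _).1 hR.isUnit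
  have hSd := (isUnit_iff_isUnit_det _).1 hS.isUnit
  have hRd' := (isUnit_iff_isUnit_det _).1 hR'.isUnit
  have hSd' := (isUnit_iff_isUnit_det _).1 hS'.isUnit
  have hLN : L (c • S - S') = c • R⁻¹ - R'⁻¹ := by rw [map_sub, map_real_smul, h1, h1']
  have hcancel : ∀ B : Mat (m + 1), c • c⁻¹ • B = B := fun B => smul_inv_smul₀ hc.ne' B
  have hZ1 : R' - c⁻¹ • R = R' * L (c • S - S') * (c⁻¹ • R) := by
    rw [hLN, Matrix.mul_sub, mul_nonsing_inv _ hRd', Matrix.sub_mul, Matrix.one_mul,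
      Matrix.mul_smul, Matrix.mul_smul, Matrix.smul_mul, inv_smul_smul₀ hc.ne', Matrix.mul_assoc,
      nonsing_inv_mul _ hRd, Matrix.mul_one]
  have hZ2 : R' - c⁻¹ • R = (c⁻¹ • R) * L (c • S - S') * R' := by
    rw [hLN, Matrix.mul_sub, Matrix.sub_mul, Matrix.mul_assoc _ R'⁻¹, nonsing_inv_mul _ hRd',
      Matrix.mul_one, Matrix.smul_mul, Matrix.mul_smul, smul_comm, hcancel,
      mul_nonsing_inv _ hRd, Matrix.one_mul]
  have hQ : (c⁻¹ • R).PosDef := hR.smul (inv_pos.2 hc)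
  have hD := hL _ hN
  -- Substituting the identity `hZ2` into `hZ1` exhibits the difference as a sum of congruences of
  -- positive matrices.
  have hZ : (R' - c⁻¹ • R).PosSemidef := by
    have h3 : R' - c⁻¹ • R = (c⁻¹ • R) * L (c • S - S') * (c⁻¹ • R) +
        (c⁻¹ • R) * (L (c • S - S') * R' * L (c • S - S')) * (c⁻¹ • R) := by
      calc R' - c⁻¹ • R = (c⁻¹ • R + (R' - c⁻¹ • R)) * L (c • S - S') * (c⁻¹ • R) := by
            rw [add_sub_cancel, ← hZ1]
        _ = _ := by
            rw [hZ2]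
            simp only [Matrix.add_mul, Matrix.mul_assoc]
    rw [h3]
    exact (mul_mul_posSemidef hQ.1 hD).add
      (mul_mul_posSemidef hQ.1 (mul_mul_posSemidef hD.1 hR'.posSemidef))
  have hW1 : hsAdjoint L (R' - c⁻¹ • R) = S'⁻¹ - c⁻¹ • S⁻¹ := by
    rw [map_sub, map_real_smul, h2, h2']
  have hW : hsAdjoint L (R' - c⁻¹ • R) = S'⁻¹ * (c • S - S') * (c⁻¹ • S⁻¹) := by
    rw [hW1, Matrix.mul_sub, nonsing_inv_mul _ hSd', Matrix.sub_mul, Matrix.one_mul,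
      Matrix.mul_smul, Matrix.mul_smul, Matrix.smul_mul, inv_smul_smul₀ hc.ne', Matrix.mul_assoc,
      mul_nonsing_inv _ hSd, Matrix.mul_one]
  have hQS : (c⁻¹ • S⁻¹).PosDef := hS.inv.smul (inv_pos.2 hc)
  have hWh : (hsAdjoint L (R' - c⁻¹ • R)).IsHermitian := by
    rw [hW1]
    exact hS'.inv.1.sub hQS.1
  -- After removal of invertible factors this reads `rank (L N) ≤ rank N` for `N = c • S - S'`.
  have hrk := rank_le_rank_hsAdjoint hL hr hZ hWh
  rw [hW, rank_mul_mul_of_isUnit hS'.inv.isUnit hQS.isUnit, hZ1,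
    rank_mul_mul_of_isUnit hR'.isUnit hQ.isUnit] at hrk
  have hN0 : c • S - S' = 0 := by
    by_contra hne
    have hle : (c • S - S').rank ≤ m + 1 := by simpa using (c • S - S').rank_le_width
    rcases hr _ hN hne with h | h
    · exact hNu (posDef_of_rank_eq hN (le_antisymm hle (h.symm.le.trans hrk))).isUnit
    · omega
  refine ⟨c, hc, (sub_eq_zero.1 hN0).symm, sub_eq_zero.1 ?_⟩
  rw [hZ1, hN0, map_zero, Matrix.mul_zero, Matrix.zero_mul]

/-! ### From pairs `(S, R)` to scalings `(X, Y)`. -/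

theorem scale_apply (L : Mat n →ₗ[ℂ] Mat n) (X Y A : Mat n) :
    scale L X Y A = Yᴴ * L (X * A * Xᴴ) * Y := rfl

theorem hsAdjoint_scale (L : Mat n →ₗ[ℂ] Mat n) (X Y B : Mat n) :
    hsAdjoint (scale L X Y) B = Xᴴ * hsAdjoint L (Y * B * Yᴴ) * X := by
  refine ext_iff_trace_mul_left.2 fun A => ?_
  have h1 := trace_conjTranspose_mul_hsAdjoint (scale L X Y) Aᴴ B
  have h2 := trace_conjTranspose_mul_hsAdjoint L (X * Aᴴ * Xᴴ) (Y * B * Yᴴ)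
  simp only [conjTranspose_conjTranspose, conjTranspose_mul, scale_apply] at h1 h2
  rw [h1]
  calc _ = ((L (X * Aᴴ * Xᴴ))ᴴ * (Y * B * Yᴴ)).trace := by
        rw [Matrix.mul_assoc, trace_mul_comm]
        simp only [Matrix.mul_assoc]
    _ = (X * (A * Xᴴ * hsAdjoint L (Y * B * Yᴴ))).trace := by
        rw [← h2]
        simp only [Matrix.mul_assoc]
    _ = _ := by
        rw [trace_mul_comm]
        simp only [Matrix.mul_assoc]

theorem isDoublyStochastic_scale_iff (L : Mat n →ₗ[ℂ] Mat n) (X Y : Mat n) :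
    IsDoublyStochastic (scale L X Y) ↔
      Yᴴ * L (X * Xᴴ) * Y = 1 ∧ Xᴴ * hsAdjoint L (Y * Yᴴ) * X = 1 := by
  rw [IsDoublyStochastic, hsAdjoint_scale]
  simp [scale]

/-- Invertibility of `Y` is automatic, which is what allows arbitrary scaling matrices in the
theorem. -/
theorem conjTranspose_mul_mul_eq_one_iff {A Y : Mat n} :
    Yᴴ * A * Y = 1 ↔ IsUnit Y ∧ A = (Y * Yᴴ)⁻¹ := by
  constructor
  · intro h
    have hY : IsUnit Y := IsUnit.of_mul_eq_one_right _ h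
    have hYd := (isUnit_iff_isUnit_det _).1 hY
    refine ⟨hY, ?_⟩
    symm
    apply inv_eq_right_inv
    have h1 : Yᴴ * A = Y⁻¹ := (inv_eq_left_inv h).symm
    rw [Matrix.mul_assoc, h1, mul_nonsing_inv _ hYd]
  · rintro ⟨hY, rfl⟩
    have hYd := (isUnit_iff_isUnit_det _).1 hY
    have hYd' : IsUnit Yᴴ.det := by rw [det_conjTranspose]; exact hYd.star
    rw [Matrix.mul_inv_rev, mul_nonsing_inv_cancel_left _ _ hYd', nonsing_inv_mul _ hYd]

theorem posDef_mul_conjTranspose {X : Mat n} (hX : IsUnit X) : (X * Xᴴ).PosDef := by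
  have := (IsUnit.posDef_star_right_conjugate_iff (x := (1 : Mat n)) hX).2 PosDef.one
  rwa [Matrix.mul_one, star_eq_conjTranspose] at this

theorem eq_of_mul_self_eq {A B : Mat n} (hA : A.PosDef) (hB : B.PosDef) (h : A * A = B * B) :
    A = B := by
  rw [← CFC.sqrt_unique h hA.posSemidef.nonneg,
    CFC.sqrt_unique rfl hB.posSemidef.nonneg]

theorem scale_smul_smul (L : Mat n →ₗ[ℂ] Mat n) (X Y : Mat n) {c : ℝ} (hc : c ≠ 0) :
    scale L (c • X) (c⁻¹ • Y) = scale L X Y := by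
  ext1 A
  simp only [scale_apply, conjTranspose_smul, Matrix.smul_mul,
    Matrix.mul_smul, map_real_smul, star_trivial, smul_smul]
  field_simp
  simp

/-- The unitary is `c⁻¹ X⁻¹ X'`, as in a polar decomposition. -/
theorem exists_unitary_of_mul_conjTranspose {X X' : Mat n} (hX : IsUnit X) {c : ℝ} (hc : 0 < c)
    (h : X' * X'ᴴ = c ^ 2 • (X * Xᴴ)) :
    ∃ U ∈ unitaryGroup (Fin n) ℂ, X' = c • (X * U) := by
  have hd := (isUnit_iff_isUnit_det _).1 hX
  have hd' : IsUnit Xᴴ.det := by rw [det_conjTranspose]; exact hd.star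
  refine ⟨c⁻¹ • (X⁻¹ * X'), ?_, ?_⟩
  · rw [mem_unitaryGroup_iff, star_eq_conjTranspose, conjTranspose_smul, conjTranspose_mul,
      Matrix.smul_mul, Matrix.mul_smul, star_trivial, Matrix.mul_assoc, ← Matrix.mul_assoc X', h,
      Matrix.smul_mul, Matrix.mul_smul, conjTranspose_nonsing_inv, Matrix.mul_assoc,
      mul_nonsing_inv _ hd', Matrix.mul_one, nonsing_inv_mul _ hd, smul_smul, smul_smul]
    have : c⁻¹ * c⁻¹ * c ^ 2 = 1 := by field_simp
    rw [this, one_smul]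
  · rw [Matrix.mul_smul, smul_inv_smul₀ hc.ne', mul_nonsing_inv_cancel_left _ _ hd]

end OperatorScaling


/-! ### The main theorem. -/

theorem mainTheorem3 (n : ℕ) (E : Mat n →ₚ[ℂ] Mat n) (hE0 : E ≠ 0)
    (hE : IsFullyIndecomposable E.toLinearMap) :
    -- existence of a scaling, and its uniqueness up to the trivial freedom
    (∃ X Y : Mat n, X.PosDef ∧ Y.PosDef ∧ IsDoublyStochastic (scale E.toLinearMap X Y) ∧
      (∀ X' Y' : Mat n, X'.PosDef → Y'.PosDef →
        IsDoublyStochastic (scale E.toLinearMap X' Y') →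
          ∃ c : ℝ, 0 < c ∧ X' = c • X ∧ Y' = c⁻¹ • Y) ∧
      (∀ X' Y' : Mat n, IsDoublyStochastic (scale E.toLinearMap X' Y') ↔
        ∃ c : ℝ, 0 < c ∧ ∃ U ∈ Matrix.unitaryGroup (Fin n) ℂ,
          ∃ V ∈ Matrix.unitaryGroup (Fin n) ℂ,
            X' = c • (X * U) ∧ Y' = c⁻¹ • (Y * V))) ∧
    -- the scaled map itself is unique among the scalings by positive definite matrices
    (∃! T : Mat n →ₗ[ℂ] Mat n, IsDoublyStochastic T ∧
      ∃ X Y : Mat n, X.PosDef ∧ Y.PosDef ∧ T = scale E.toLinearMap X Y) := by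
  set L := E.toLinearMap with hLdef
  have hL : ∀ A : Mat n, A.PosSemidef → (L A).PosSemidef := fun A hA =>
    Matrix.nonneg_iff_posSemidef.1 (map_nonneg E hA.nonneg)
  have hL0 : L ≠ 0 := fun h => hE0 (by
    ext1 A
    exact LinearMap.congr_fun h A)
  have hr : IsRankIncreasing L := fun A hA hA0 => rank_lt_rank_map hL hL0 hE hA hA0
  -- For `n = 0` the only linear map is zero, which is excluded.
  obtain _ | m := n
  · exact absurd (Subsingleton.elim _ _) hL0
  obtain ⟨S, R, hS, hR, hSR, hRS⟩ := exists_scaling_pair hL hr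
  obtain ⟨X, hX, rfl⟩ := exists_posDef_mul_self hS
  obtain ⟨Y, hY, rfl⟩ := exists_posDef_mul_self hR
  have hDS : IsDoublyStochastic (scale L X Y) := by
    rw [isDoublyStochastic_scale_iff, conjTranspose_mul_mul_eq_one_iff,
      conjTranspose_mul_mul_eq_one_iff, hX.1.eq, hY.1.eq]
    exact ⟨⟨hY.isUnit, hSR⟩, hX.isUnit, hRS⟩
  have huniq : ∀ X' Y' : Mat (m + 1), IsDoublyStochastic (scale L X' Y') →
      ∃ c : ℝ, 0 < c ∧ X' * X'ᴴ = c ^ 2 • (X * X) ∧ Y' * Y'ᴴ = c⁻¹ ^ 2 • (Y * Y) := by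
    intro X' Y' h
    rw [isDoublyStochastic_scale_iff, conjTranspose_mul_mul_eq_one_iff,
      conjTranspose_mul_mul_eq_one_iff] at h
    obtain ⟨⟨hY', h1⟩, hX', h2⟩ := h
    obtain ⟨c, hc, h3, h4⟩ := scaling_pair_unique hL hr hS hR (posDef_mul_conjTranspose hX')
      (posDef_mul_conjTranspose hY') hSR hRS h1 h2
    -- `c` scales `S = X * X`, so `X` scales by its square root.
    refine ⟨√c, Real.sqrt_pos.2 hc, ?_, ?_⟩
    · rw [Real.sq_sqrt hc.le, h3]
    · rw [inv_pow, Real.sq_sqrt hc.le, h4]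
  have huniqPD : ∀ X' Y' : Mat (m + 1), X'.PosDef → Y'.PosDef →
      IsDoublyStochastic (scale L X' Y') → ∃ c : ℝ, 0 < c ∧ X' = c • X ∧ Y' = c⁻¹ • Y := by
    intro X' Y' hX' hY' h
    obtain ⟨c, hc, h1, h2⟩ := huniq X' Y' h
    rw [hX'.1.eq] at h1
    rw [hY'.1.eq] at h2
    refine ⟨c, hc, eq_of_mul_self_eq hX' (hX.smul hc) ?_,
      eq_of_mul_self_eq hY' (hY.smul (inv_pos.2 hc)) ?_⟩
    · rw [h1, Matrix.smul_mul, Matrix.mul_smul, smul_smul, sq]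
    · rw [h2, Matrix.smul_mul, Matrix.mul_smul, smul_smul, sq]
  refine ⟨⟨X, Y, hX, hY, hDS, huniqPD, fun X' Y' => ⟨fun h => ?_, ?_⟩⟩, scale L X Y,
    ⟨hDS, X, Y, hX, hY, rfl⟩, ?_⟩
  · obtain ⟨c, hc, h1, h2⟩ := huniq X' Y' h
    obtain ⟨U, hU, hXU⟩ := exists_unitary_of_mul_conjTranspose (X' := X') hX.isUnit hc
      (by rwa [hX.1.eq])
    obtain ⟨V, hV, hYV⟩ := exists_unitary_of_mul_conjTranspose (X' := Y') hY.isUnit (inv_pos.2 hc)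
      (by rwa [hY.1.eq])
    exact ⟨c, hc, U, hU, V, hV, hXU, hYV⟩
  · rintro ⟨c, hc, U, hU, V, hV, rfl, rfl⟩
    rw [scale_smul_smul _ _ _ hc.ne']
    have hconj : ∀ {Z W A : Mat (m + 1)}, W ∈ Matrix.unitaryGroup (Fin (m + 1)) ℂ →
        Zᴴ * A * Z = 1 → (Z * W)ᴴ * A * (Z * W) = 1 := by
      intro Z W A hW h
      calc (Z * W)ᴴ * A * (Z * W) = Wᴴ * (Zᴴ * A * Z) * W := by
            simp only [Matrix.conjTranspose_mul, Matrix.mul_assoc]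
        _ = 1 := by rw [h, Matrix.mul_one, conjTranspose_mul_of_mem_unitaryGroup hW]
    have hself : ∀ {Z W : Mat (m + 1)}, W ∈ Matrix.unitaryGroup (Fin (m + 1)) ℂ →
        Z * W * (Z * W)ᴴ = Z * Zᴴ := by
      intro Z W hW
      rw [Matrix.conjTranspose_mul, Matrix.mul_assoc, ← Matrix.mul_assoc W,
        mul_conjTranspose_of_mem_unitaryGroup hW, Matrix.one_mul]
    rw [isDoublyStochastic_scale_iff] at hDS ⊢
    rw [hself hU, hself hV]
    exact ⟨hconj hV hDS.1, hconj hU hDS.2⟩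
  · rintro T ⟨hT, X', Y', hX', hY', rfl⟩
    obtain ⟨c, hc, rfl, rfl⟩ := huniqPD X' Y' hX' hY' hT
    exact scale_smul_smul _ _ _ hc.ne'
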